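/- Let $K$ be a field and $n\ge 0$. Let $A_n$ be the quiver with vertices $1,\dots,n$ and exactly one arrow $i\to i+1$ for each $1\le i\le n-1$, and let $\operatorname{rep} A_n$ be the category of its finite-dimensional representations over $K$. For $1\le i\le j\le n$ let $E^{ij}$ be the representation with the vector space $K$ at each vertex $p$ with $i\le p\le j$, zero at all other vertices, identity maps between successive copies of $K$, and zero maps elsewhere. A full additive subcategory of $\operatorname{rep} A_n$ is a full subcategory whose objects are, up to isomorphism, all finite direct sums (including the empty sum $0$) of members of some set of indecomposable representations. A representation $Y$ is an extension of $Z$ by $X$ if $Y$ has a subrepresentation isomorphic to $X$ such that the corresponding quotient representation is isomorphic to $Z$. A torsion class is a full additive subcategory $\mathcal T$ that is closed under quotients (if $Y\in\mathcal T$ and there is a surjection $Y\to Z$, then $Z\in\mathcal T$) and under extensions (if $X,Z\in\mathcal T$ and $Y$ is an extension of $Z$ by $X$, then $Y\in\mathcal T$). A bracket vector of length $n$ is a tuple $\mathbf a=(a_1,\dots,a_n)$ of integers with $0\le a_i\le n+1-i$ such that for all $1\le i\le n$ and all integers $0\le j\le a_i$ one has $j+a_{i+j}\le a_i$, where $a_{n+1}:=0$.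 For such $\mathbf a$ let $\mathcal C_{\mathbf a}$ be the full subcategory of $\operatorname{rep} A_n$ whose objects are the representations isomorphic to finite direct sums of representations $E^{ij}$ with $i\le j<i+a_i$. **Theorem.** The torsion classes of $\operatorname{rep} A_n$ are exactly the subcategories $\mathcal C_{\mathbf a}$ for $\mathbf a$ a bracket vector of length $n$. -/

import Mathlib

open CategoryTheory

universe u v w

/-- A representation over the field `K` of the quiver `Q`: a finite-dimensional `K`-vector space
at each vertex and a linear map for each arrow. -/
structure QRep (K : Type u) [Field K] (Q : Type v) [Quiver.{w} Q] where
  /-- the vector space at a vertex -/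
  V : Q → Type u
  [addCommGroup : ∀ p, AddCommGroup (V p)]
  [module : ∀ p, Module K (V p)]
  [finite : ∀ p, FiniteDimensional K (V p)]
  /-- the linear map along an arrow -/
  map : ∀ {p q : Q}, (p ⟶ q) → (V p →ₗ[K] V q)

namespace QRep

attribute [instance] QRep.addCommGroup QRep.module QRep.finite

section General

variable {K : Type u} [Field K] {Q : Type v} [Quiver.{w} Q]

/-- Morphisms of representations: families of linear maps commuting with the structure maps. -/
@[ext]
structure Hom (X Y : QRep K Q) where
  /-- the component at a vertex -/
  app : ∀ p, X.V p →ₗ[K] Y.V p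
  comm : ∀ {p q : Q} (α : p ⟶ q), Y.map α ∘ₗ app p = app q ∘ₗ X.map α

/-- The category `rep Q` of representations of `Q` over `K`. -/
instance : Category (QRep K Q) where
  Hom X Y := Hom X Y
  id X := { app := fun _ => LinearMap.id, comm := fun _ => rfl }
  comp {X Y Z} f g :=
    { app := fun p => g.app p ∘ₗ f.app p
      comm := fun {p q} α => by
        rw [← LinearMap.comp_assoc, g.comm, LinearMap.comp_assoc, f.comm, LinearMap.comp_assoc] }

/-- A surjection is a morphism all of whose linear maps are surjective. -/
def IsSurjection {X Y : QRep K Q} (f : X ⟶ Y) : Prop :=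
  ∀ p, Function.Surjective (Hom.app f p)

/-- A representation is zero when all its vector spaces are zero. -/
def IsZeroRep (X : QRep K Q) : Prop :=
  ∀ p, Subsingleton (X.V p)

/-- The direct sum of two representations. -/
def directSum (X Y : QRep K Q) : QRep K Q where
  V p := X.V p × Y.V p
  map α := (X.map α).prodMap (Y.map α)

/-- The direct sum of a finite family of representations (the zero representation if the family
is empty). -/
def finDirectSum {m : ℕ} (X : Fin m → QRep K Q) : QRep K Q where
  V p := ∀ k, (X k).V p
  map α := LinearMap.pi fun k => (X k).map α ∘ₗ LinearMap.proj k

/-- A representation is indecomposable if it is nonzero and is not isomorphic to the direct sum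
of two nonzero representations. -/
def IsIndecomposable (X : QRep K Q) : Prop :=
  ¬ X.IsZeroRep ∧
    ∀ Y Z : QRep K Q, Nonempty (X ≅ directSum Y Z) → Y.IsZeroRep ∨ Z.IsZeroRep

/-- A subrepresentation of `Y`: a subspace at each vertex, stable under the structure maps. -/
structure Subrep (Y : QRep K Q) where
  /-- the subspace at a vertex -/
  space : ∀ p, Submodule K (Y.V p)
  map_mem : ∀ {p q : Q} (α : p ⟶ q), ∀ y ∈ space p, Y.map α y ∈ space q

/-- A subrepresentation as a representation, with the restricted maps. -/
def Subrep.toQRep {Y : QRep K Q} (W : Subrep Y) : QRep K Q where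
  V p := W.space p
  map α := (Y.map α).restrict (W.map_mem α)

/-- The quotient representation `Y / W`, with the induced maps. -/
def Subrep.quotient {Y : QRep K Q} (W : Subrep Y) : QRep K Q where
  V p := Y.V p ⧸ W.space p
  map {p q} α := (W.space p).mapQ (W.space q) (Y.map α) (W.map_mem α)

/-- `Y` is an extension of `Z` by `X`: some subrepresentation of `Y` is isomorphic to `X`, with
quotient representation isomorphic to `Z`. -/
def IsExtension (Y Z X : QRep K Q) : Prop :=
  ∃ W : Subrep Y, Nonempty (W.toQRep ≅ X) ∧ Nonempty (W.quotient ≅ Z)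

/-- The full subcategory of all representations that are isomorphic to a finite direct sum of
members of `S`. -/
def sumsOf (S : Set (QRep K Q)) : ObjectProperty (QRep K Q) := fun X =>
  ∃ (m : ℕ) (Y : Fin m → QRep K Q), (∀ k, Y k ∈ S) ∧ Nonempty (X ≅ finDirectSum Y)

/-- A full additive subcategory: its objects are, up to isomorphism, all finite direct sums of
representations from some set of indecomposables. -/
def IsFullAdditive (T : ObjectProperty (QRep K Q)) : Prop :=
  ∃ S : Set (QRep K Q), (∀ X ∈ S, X.IsIndecomposable) ∧ T = sumsOf S

/-- A torsion class: a full additive subcategory closed under quotients and extensions. -/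
structure IsTorsionClass (T : ObjectProperty (QRep K Q)) : Prop where
  additive : IsFullAdditive T
  quotient : ∀ (Y Z : QRep K Q) (f : Y ⟶ Z), IsSurjection f → T Y → T Z
  extension : ∀ X Y Z : QRep K Q, IsExtension Y Z X → T X → T Z → T Y

end General

end QRep

/-- The vertices `1, …, n` of the quiver `A_n`. -/
@[ext]
structure AVertex (n : ℕ) where
  /-- the number of the vertex -/
  val : ℕ
  one_le : 1 ≤ val
  le : val ≤ n

/-- The quiver `A_n`, an oriented path: one arrow `p ⟶ p + 1` for each `1 ≤ p ≤ n - 1`, and no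
other arrows. -/
instance (n : ℕ) : Quiver.{0} (AVertex n) where
  Hom p q := PLift (p.val + 1 = q.val)

open Classical in
/-- The representation `E^{ij}` of `A_n`: it is `K` at the vertices `p` with `i ≤ p ≤ j` (as the
subspace `⊤` of `K`) and `0` (the subspace `⊥` of `K`) at the other vertices, with identity maps
between successive copies of `K` and zero maps elsewhere. -/
noncomputable def intervalRep (K : Type u) [Field K] {n : ℕ} (i j : AVertex n) :
    QRep K (AVertex n) where
  V p := ((if i.val ≤ p.val ∧ p.val ≤ j.val then ⊤ else ⊥ : Submodule K K) : Type u)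
  map {p q} α :=
    if h : i.val ≤ p.val ∧ q.val ≤ j.val then
      Submodule.inclusion (by
        have hpq : p.val + 1 = q.val := α.down
        rw [if_pos (show i.val ≤ q.val ∧ q.val ≤ j.val by omega)]
        exact le_top)
    else 0

/-- The entry `a_m` of an `n`-tuple `a = (a_1, …, a_n)`, with the convention `a_m = 0` for `m`
outside `1, …, n` (only `m = n + 1` is ever used). -/
def AVertex.entry {n : ℕ} (a : AVertex n → ℕ) (m : ℕ) : ℕ :=
  if h : 1 ≤ m ∧ m ≤ n then a ⟨m, h.1, h.2⟩ else 0

/-- Bracket vectors of length `n`: tuples `(a_1, …, a_n)` of natural numbers with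
`a_i ≤ n + 1 - i`, such that `j + a_{i+j} ≤ a_i` whenever `j ≤ a_i`. -/
structure IsBracketVector {n : ℕ} (a : AVertex n → ℕ) : Prop where
  bound : ∀ i, a i ≤ n + 1 - i.val
  bracket : ∀ (i : AVertex n) (j : ℕ), j ≤ a i → j + AVertex.entry a (i.val + j) ≤ a i

/-- The full subcategory `C_a` of `rep A_n`: the representations isomorphic to finite direct sums
of representations `E^{ij}` with `i ≤ j < i + a_i`. -/
def bracketSubcategory (K : Type u) [Field K] {n : ℕ} (a : AVertex n → ℕ) :
    ObjectProperty (QRep K (AVertex n)) :=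
  QRep.sumsOf {X | ∃ i j : AVertex n, i.val ≤ j.val ∧ j.val < i.val + a i ∧ X = intervalRep K i j}

/-!
The theorem rests on a criterion for membership in `C_a` that does not mention decompositions.
For a representation `X` of `A_n` and a bracket vector `a`, call `X` *short* (`IsShort`) if for
every vertex `i` with `m = i + a_i ≤ n` the image of `X_i` in `X_m` is contained in the image of
`X_{i-1}` in `X_m`, where `X_0 = 0`.

Every representation of `A_n` is a direct sum of interval representations `E^{ij}`
(`exists_iso_finDirectSum_intervalRep`), since a nonzero one has an interval summand
(`exists_iso_directSum_intervalRep`). Moreover `E^{ij}` is short exactly when `j < i + a_i`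
(`isShort_intervalRep_iff`). Shortness clearly passes to quotients, in particular to summands. It
also passes to extensions (`IsShort.of_isExtension`), and this is where the bracket condition
enters: the intervals of a short `X` that start in `[i, i + a_i]` end before `m = i + a_i`, so
that all of `X_m` comes from `X_{i-1}` (`IsShort.imageFrom_eq_top`). A vector of `Y_i`, for an
extension `Y` of `Z` by `X`, therefore agrees at `m` with one coming from `Y_{i-1}`: this holds
modulo `X_m` because `Z` is short, and the error in `X_m` comes from `X_{i-1}`. Finite direct sums
are iterated extensions, so `C_a` consists of the short representations
(`bracketSubcategory_iff_isShort`), and it is a torsion class.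

Conversely, a torsion class `T` is determined by the intervals it contains. As `E^{ij'}` is a
quotient of `E^{ij}` for `i ≤ j' ≤ j`, these are given by the length `a_i` of the longest interval
starting at `i` (`lengthVector`), so that `T = C_a`. The bracket condition for `a` holds because
`E^{ij}` is an extension of `E^{i,i'-1}` by `E^{i'j}` for `i < i' ≤ j`
(`isExtension_intervalRep`).
-/

namespace QRep

section Arbitrary

variable {K : Type u} [Field K] {Q : Type v} [Quiver.{w} Q]

/-! ### Representations of an arbitrary quiver -/

theorem app_map {X Y : QRep K Q} (f : X ⟶ Y) {p q : Q} (α : p ⟶ q) (x : X.V p) :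
    Hom.app f q (X.map α x) = Y.map α (Hom.app f p x) :=
  (LinearMap.congr_fun (Hom.comm f α) x).symm

theorem nonempty_iso_of_bijective {X Y : QRep K Q} (f : X ⟶ Y)
    (hf : ∀ p, Function.Bijective (Hom.app f p)) : Nonempty (X ≅ Y) := by
  let e : ∀ p, X.V p ≃ₗ[K] Y.V p := fun p => LinearEquiv.ofBijective (Hom.app f p) (hf p)
  let g : Y ⟶ X :=
    { app := fun p => (e p).symm.toLinearMap
      comm := by
        intro p q α
        ext y
        apply (e q).injective
        obtain ⟨x, rfl⟩ := (e p).surjective y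
        rw [LinearMap.comp_apply, LinearMap.comp_apply, LinearEquiv.coe_coe, LinearEquiv.coe_coe,
          LinearEquiv.symm_apply_apply, LinearEquiv.apply_symm_apply]
        exact app_map f α x }
  refine ⟨⟨f, g, Hom.ext ?_, Hom.ext ?_⟩⟩
  · funext p
    ext x
    exact (e p).symm_apply_apply x
  · funext p
    ext y
    exact (e p).apply_symm_apply y

theorem hom_app_inv_app {X Y : QRep K Q} (e : X ≅ Y) (p : Q) (y : Y.V p) :
    Hom.app e.hom p (Hom.app e.inv p y) = y := by
  have h : Hom.app (e.inv ≫ e.hom) p y = y := by rw [e.inv_hom_id]; rfl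
  exact h

theorem isSurjection_hom {X Y : QRep K Q} (e : X ≅ Y) : IsSurjection e.hom :=
  fun p y => ⟨_, hom_app_inv_app e p y⟩

theorem bijective_hom_app {X Y : QRep K Q} (e : X ≅ Y) (p : Q) :
    Function.Bijective (Hom.app e.hom p) :=
  ⟨Function.LeftInverse.injective (hom_app_inv_app e.symm p), isSurjection_hom e p⟩

theorem IsSurjection.comp {X Y Z : QRep K Q} {f : X ⟶ Y} {g : Y ⟶ Z} (hf : IsSurjection f)
    (hg : IsSurjection g) : IsSurjection (f ≫ g) :=
  fun p => (hg p).comp (hf p)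

/-- A short exact sequence `0 ⟶ X ⟶ Y ⟶ Z ⟶ 0` exhibits `Y` as an extension of `Z` by `X`. -/
theorem isExtension_of_exact {X Y Z : QRep K Q} (f : X ⟶ Y) (g : Y ⟶ Z)
    (hf : ∀ p, Function.Injective (Hom.app f p)) (hg : IsSurjection g)
    (hfg : ∀ p, LinearMap.range (Hom.app f p) = LinearMap.ker (Hom.app g p)) :
    IsExtension Y Z X := by
  have hmem : ∀ {p q : Q} (α : p ⟶ q), ∀ y ∈ LinearMap.ker (Hom.app g p),
      Y.map α y ∈ LinearMap.ker (Hom.app g q) := by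
    intro p q α y hy
    rw [LinearMap.mem_ker] at hy ⊢
    rw [app_map, hy, map_zero]
  have hfmem : ∀ p x, Hom.app f p x ∈ LinearMap.ker (Hom.app g p) := fun p x => by
    rw [← hfg]; exact ⟨x, rfl⟩
  let W : Subrep Y := ⟨fun p => LinearMap.ker (Hom.app g p), hmem⟩
  let f' : X ⟶ W.toQRep :=
    { app := fun p => (Hom.app f p).codRestrict (LinearMap.ker (Hom.app g p)) (hfmem p)
      comm := by
        intro p q α
        ext x
        exact Subtype.ext (app_map f α x).symm }
  let g' : W.quotient ⟶ Z :=
    { app := fun p => (LinearMap.ker (Hom.app g p)).liftQ (Hom.app g p) le_rfl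
      comm := by
        intro p q α
        refine Submodule.linearMap_qext (LinearMap.ker (Hom.app g p)) ?_
        ext y
        exact (app_map g α y).symm }
  refine ⟨W, ?_, nonempty_iso_of_bijective g' fun p => ⟨?_, ?_⟩⟩
  · obtain ⟨e⟩ := nonempty_iso_of_bijective f' fun p => by
      refine ⟨fun x y h => hf p (congrArg Subtype.val h), ?_⟩
      rintro ⟨y, hy⟩
      have hy' : y ∈ LinearMap.range (Hom.app f p) := by rw [hfg]; exact hy
      obtain ⟨x, rfl⟩ := hy'
      exact ⟨x, rfl⟩
    exact ⟨e.symm⟩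
  · exact LinearMap.ker_eq_bot.1 (Submodule.ker_liftQ_eq_bot _ _ _ le_rfl)
  · intro z
    obtain ⟨y, rfl⟩ := hg p z
    exact ⟨Submodule.Quotient.mk y, rfl⟩

/-- An extension of `Z` by `X` comes from a short exact sequence `0 ⟶ X ⟶ Y ⟶ Z ⟶ 0`. -/
theorem IsExtension.exists_exact {X Y Z : QRep K Q} (h : IsExtension Y Z X) :
    ∃ (f : X ⟶ Y) (g : Y ⟶ Z), IsSurjection g ∧
      ∀ p y, Hom.app g p y = 0 → ∃ x, Hom.app f p x = y := by
  obtain ⟨W, ⟨e⟩, ⟨e'⟩⟩ := h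
  let i : W.toQRep ⟶ Y := { app := fun p => (W.space p).subtype, comm := fun _ => rfl }
  let π : Y ⟶ W.quotient := { app := fun p => (W.space p).mkQ, comm := fun _ => rfl }
  have hπ : IsSurjection π := fun p => (W.space p).mkQ_surjective
  refine ⟨e.inv ≫ i, π ≫ e'.hom, hπ.comp (isSurjection_hom e'), fun p y hy => ?_⟩
  have h0 : Hom.app π p y = 0 :=
    (bijective_hom_app e' p).1 (hy.trans (map_zero _).symm)
  have hy' : y ∈ W.space p := (Submodule.Quotient.mk_eq_zero _).1 h0
  obtain ⟨x, hx⟩ := isSurjection_hom e.symm p (⟨y, hy'⟩ : W.space p)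
  exact ⟨x, congrArg Subtype.val hx⟩

/-- The projection of a finite direct sum onto a summand. -/
def finDirectSumProj {m : ℕ} (X : Fin m → QRep K Q) (k : Fin m) : finDirectSum X ⟶ X k where
  app _ := LinearMap.proj k
  comm _ := rfl

theorem isSurjection_finDirectSumProj {m : ℕ} (X : Fin m → QRep K Q) (k : Fin m) :
    IsSurjection (finDirectSumProj X k) :=
  fun p => LinearMap.proj_surjective (R := K) (φ := fun k => (X k).V p) k

theorem isExtension_finDirectSum {m : ℕ} (X : Fin (m + 1) → QRep K Q) :
    IsExtension (finDirectSum X) (X 0) (finDirectSum fun k => X k.succ) := by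
  let f : (finDirectSum fun k => X k.succ) ⟶ finDirectSum X :=
    { app := fun p => LinearMap.pi (φ := fun k => (X k).V p)
        (Fin.cases (0 : (finDirectSum fun k => X k.succ).V p →ₗ[K] (X 0).V p) fun k =>
          Hom.app (finDirectSumProj (fun k => X k.succ) k) p)
      comm := by
        intro p q α
        refine LinearMap.ext fun x => funext fun k => ?_
        refine Fin.cases ?_ (fun k => ?_) k
        · exact LinearMap.map_zero ((X 0).map α)
        · rfl }
  refine isExtension_of_exact f (finDirectSumProj X 0) (fun p x y h => funext fun k => ?_)
    (isSurjection_finDirectSumProj X 0) fun p => le_antisymm ?_ ?_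
  · exact congrFun h k.succ
  · rintro _ ⟨x, rfl⟩
    rfl
  · intro y hy
    refine ⟨fun k => y k.succ, funext fun k => ?_⟩
    refine Fin.cases ?_ (fun k => ?_) k
    · exact hy.symm
    · rfl

/-- A property of representations that holds for zero and is closed under extensions is closed
under finite direct sums. -/
theorem prop_finDirectSum {T : ObjectProperty (QRep K Q)} (hzero : ∀ X, X.IsZeroRep → T X)
    (hext : ∀ X Y Z : QRep K Q, IsExtension Y Z X → T X → T Z → T Y) :
    ∀ {m : ℕ} (X : Fin m → QRep K Q), (∀ k, T (X k)) → T (finDirectSum X)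
  | 0, X, _ => hzero _ fun p => inferInstanceAs (Subsingleton (∀ k : Fin 0, (X k).V p))
  | _ + 1, X, h => hext _ _ _ (isExtension_finDirectSum X)
      (prop_finDirectSum hzero hext _ fun k => h k.succ) (h 0)

theorem IsZeroRep.nonempty_iso_finDirectSum {X : QRep K Q} (hX : X.IsZeroRep)
    (Y : Fin 0 → QRep K Q) : Nonempty (X ≅ finDirectSum Y) := by
  let f : X ⟶ finDirectSum Y :=
    { app := fun p => 0, comm := fun _ => by rw [LinearMap.comp_zero, LinearMap.zero_comp] }
  exact nonempty_iso_of_bijective f fun p =>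
    ⟨fun x y _ => (hX p).elim x y, fun y => ⟨0, funext fun k => k.elim0⟩⟩

theorem nonempty_iso_finDirectSum_cons {m : ℕ} {X A B : QRep K Q} (Y : Fin m → QRep K Q)
    (e : X ≅ directSum A B) (e' : B ≅ finDirectSum Y) :
    Nonempty (X ≅ finDirectSum (Fin.cons A Y : Fin (m + 1) → QRep K Q)) := by
  let Y' : Fin (m + 1) → QRep K Q := Fin.cons A Y
  let f : directSum A B ⟶ finDirectSum Y' :=
    { app := fun p => LinearMap.pi (M₂ := A.V p × B.V p) (φ := fun k => (Y' k).V p)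
        (Fin.cases (LinearMap.fst K (A.V p) (B.V p)) fun k =>
          (LinearMap.proj (R := K) (φ := fun k => (Y k).V p) k ∘ₗ Hom.app e'.hom p) ∘ₗ
            LinearMap.snd K (A.V p) (B.V p))
      comm := by
        intro p q α
        refine LinearMap.ext fun x => funext fun k => ?_
        refine Fin.cases ?_ (fun k => ?_) k
        · rfl
        · exact (congrFun (app_map e'.hom α x.2) k).symm }
  obtain ⟨e''⟩ := nonempty_iso_of_bijective f fun p => by
    refine ⟨fun x y h => Prod.ext (congrFun h 0) ((bijective_hom_app e' p).1 ?_), fun y => ?_⟩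
    · exact funext fun k => congrFun h k.succ
    · obtain ⟨b, hb⟩ := (bijective_hom_app e' p).2 fun k => y k.succ
      refine ⟨(y 0, b), funext fun k => ?_⟩
      refine Fin.cases ?_ (fun k => ?_) k
      · rfl
      · exact congrFun hb k
  exact ⟨e.trans e''⟩

/-- The kernel of a morphism, as a subrepresentation. -/
def kerSubrep {X Y : QRep K Q} (f : X ⟶ Y) : Subrep X where
  space p := LinearMap.ker (Hom.app f p)
  map_mem α x hx := by
    rw [LinearMap.mem_ker] at hx ⊢
    rw [app_map, hx, map_zero]

/-- A split monomorphism `s : E ⟶ X` with retraction `r` splits off `E` as a direct summand, with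
the kernel of `r` as a complement. -/
theorem nonempty_iso_directSum_ker {E X : QRep K Q} (s : E ⟶ X) (r : X ⟶ E)
    (h : ∀ p x, Hom.app r p (Hom.app s p x) = x) :
    Nonempty (X ≅ directSum E (kerSubrep r).toQRep) := by
  let f : directSum E (kerSubrep r).toQRep ⟶ X :=
    { app := fun p => LinearMap.coprod (M := E.V p) (M₂ := LinearMap.ker (Hom.app r p))
        (Hom.app s p) (LinearMap.ker (Hom.app r p)).subtype
      comm := by
        intro p q α
        refine LinearMap.ext fun x => ?_
        change X.map α (Hom.app s p x.1 + x.2.1) = Hom.app s q (E.map α x.1) + X.map α x.2.1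
        rw [map_add, app_map] }
  have hr : ∀ p (x : LinearMap.ker (Hom.app r p)), Hom.app r p x.1 = 0 := fun p x => x.2
  obtain ⟨e⟩ := nonempty_iso_of_bijective f fun p => by
    refine ⟨(injective_iff_map_eq_zero (Hom.app f p)).2 fun x hx => ?_, fun y => ?_⟩
    · have hx' : Hom.app s p x.1 + x.2.1 = 0 := hx
      have h1 : x.1 = 0 := by
        have := congrArg (Hom.app r p) hx'
        rwa [map_add, h, hr p x.2, add_zero, map_zero] at this
      rw [h1, map_zero, zero_add] at hx'
      exact Prod.ext h1 (Subtype.ext hx')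
    · refine ⟨(Hom.app r p y, ⟨y - Hom.app s p (Hom.app r p y), ?_⟩), ?_⟩
      · change Hom.app r p (y - Hom.app s p (Hom.app r p y)) = 0
        rw [map_sub, h, sub_self]
      · exact add_sub_cancel _ y
  exact ⟨e.symm⟩

end Arbitrary

section Path

variable {K : Type u} [Field K] {n : ℕ}

/-! ### Transport along the path -/

instance : Finite (AVertex n) :=
  Finite.of_injective (fun p => (⟨p.val, Nat.lt_succ_of_le p.le⟩ : Fin (n + 1)))
    fun _ _ h => AVertex.ext (congrArg Fin.val h)

/-- The composite of the structure maps of a representation of `A_n` along the path from `p`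
to `q`. -/
noncomputable def transport (X : QRep K (AVertex n)) {p q : AVertex n} (h : p.val ≤ q.val) :
    X.V p →ₗ[K] X.V q :=
  Nat.leRec (motive := fun m hm => ∀ hn : m ≤ n, X.V p →ₗ[K] X.V ⟨m, p.one_le.trans hm, hn⟩)
    (fun _ => LinearMap.id)
    (fun m hm t hn =>
      X.map (p := ⟨m, p.one_le.trans hm, (Nat.le_succ m).trans hn⟩) ⟨rfl⟩ ∘ₗ t _) h q.le

@[simp]
theorem transport_self (X : QRep K (AVertex n)) {p : AVertex n} (h : p.val ≤ p.val) :
    X.transport h = LinearMap.id := by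
  unfold transport
  rw [Nat.leRec_self]

theorem transport_map (X : QRep K (AVertex n)) {p q r : AVertex n} (h : p.val ≤ q.val)
    (α : q ⟶ r) (h' : p.val ≤ r.val) (x : X.V p) :
    X.transport h' x = X.map α (X.transport h x) := by
  obtain ⟨q, hq, hq'⟩ := q
  obtain ⟨r, hr, hr'⟩ := r
  obtain ⟨α⟩ := α
  dsimp only at α h h'
  subst α
  unfold transport
  rw [Nat.leRec_succ _ _ h]
  rfl

/-- Induction along the path starting at `p`. -/
theorem path_induction {p : AVertex n} {P : ∀ q : AVertex n, p.val ≤ q.val → Prop}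
    (self : P p le_rfl)
    (step : ∀ {q r : AVertex n} (h : p.val ≤ q.val) (_ : q ⟶ r) (h' : p.val ≤ r.val),
      P q h → P r h') {q : AVertex n} (h : p.val ≤ q.val) : P q h := by
  obtain ⟨q, hq, hq'⟩ := q
  dsimp only at h
  induction h with
  | refl => exact self
  | @step m hm ih =>
    exact step (q := ⟨m, p.one_le.trans hm, (Nat.le_succ m).trans hq'⟩) hm ⟨rfl⟩ _ (ih _ _)

theorem transport_transport (X : QRep K (AVertex n)) {p q r : AVertex n} (h : p.val ≤ q.val)
    (h' : q.val ≤ r.val) (x : X.V p) :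
    X.transport h' (X.transport h x) = X.transport (h.trans h') x := by
  induction h' using path_induction with
  | self => simp
  | @step r s hr α hs ih =>
    rw [X.transport_map hr α, ih, ← X.transport_map (h.trans hr) α]

theorem transport_map_left (X : QRep K (AVertex n)) {p q r : AVertex n} (α : p ⟶ q)
    (h : q.val ≤ r.val) (h' : p.val ≤ r.val) (x : X.V p) :
    X.transport h (X.map α x) = X.transport h' x := by
  have hpq : p.val ≤ q.val := (Nat.le_succ _).trans_eq α.down
  rw [← X.transport_transport hpq h, X.transport_map le_rfl α, transport_self]
  rfl

theorem app_transport {X Y : QRep K (AVertex n)} (f : X ⟶ Y) {p q : AVertex n}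
    (h : p.val ≤ q.val) (x : X.V p) :
    Hom.app f q (X.transport h x) = Y.transport h (Hom.app f p x) := by
  induction h using path_induction with
  | self => simp
  | step hr α hs ih => rw [X.transport_map hr α, app_map, ih, ← Y.transport_map hr α]

/-! ### Interval representations -/

/-- The coordinate of a vector of `E^{ij}`, whose spaces are subspaces of `K`. -/
noncomputable def coord (i j p : AVertex n) : (intervalRep K i j).V p →ₗ[K] K :=
  Submodule.subtype _

theorem coord_injective (i j p : AVertex n) : Function.Injective (coord (K := K) i j p) :=
  Subtype.val_injective

/-- The inclusion of `K` as the space of `E^{ij}` at a vertex of the interval. -/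
noncomputable def ofCoord {i j p : AVertex n} (h : i.val ≤ p.val ∧ p.val ≤ j.val) :
    K →ₗ[K] (intervalRep K i j).V p :=
  Submodule.inclusion (le_of_eq (if_pos h).symm) ∘ₗ (Submodule.topEquiv (M := K)).symm.toLinearMap

@[simp]
theorem coord_ofCoord {i j p : AVertex n} (h : i.val ≤ p.val ∧ p.val ≤ j.val) (c : K) :
    coord i j p (ofCoord h c) = c := rfl

theorem eq_zero_of_notMem {i j p : AVertex n} (h : ¬ (i.val ≤ p.val ∧ p.val ≤ j.val))
    (x : (intervalRep K i j).V p) : x = 0 := by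
  have key : ∀ S : Submodule K K, S = ⊥ → ∀ y : S, y = 0 := by
    rintro _ rfl y
    exact Subsingleton.elim _ _
  exact key _ (if_neg h) x

theorem intervalRep_ext {i j p : AVertex n} {x y : (intervalRep K i j).V p}
    (h : i.val ≤ p.val → p.val ≤ j.val → coord i j p x = coord i j p y) : x = y := by
  by_cases hp : i.val ≤ p.val ∧ p.val ≤ j.val
  · exact coord_injective _ _ _ (h hp.1 hp.2)
  · rw [eq_zero_of_notMem hp x, eq_zero_of_notMem hp y]

theorem coord_map {i j p q : AVertex n} (α : p ⟶ q) (x : (intervalRep K i j).V p) :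
    coord i j q ((intervalRep K i j).map α x) =
      if i.val ≤ p.val ∧ q.val ≤ j.val then coord i j p x else 0 := by
  by_cases h : i.val ≤ p.val ∧ q.val ≤ j.val
  · rw [if_pos h]
    exact congrArg (coord i j q) (LinearMap.congr_fun (dif_pos h) x)
  · rw [if_neg h]
    exact congrArg (coord i j q) (LinearMap.congr_fun (dif_neg h) x)

theorem coord_transport {i j p q : AVertex n} (h : p.val ≤ q.val) (x : (intervalRep K i j).V p) :
    coord i j q ((intervalRep K i j).transport h x) =
      if q.val ≤ j.val then coord i j p x else 0 := by
  induction h using path_induction with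
  | self =>
    split_ifs with hj
    · simp
    · rw [eq_zero_of_notMem (fun h => hj h.2) x, map_zero, map_zero]
  | @step q r hr α hs ih =>
    have hα : q.val + 1 = r.val := α.down
    rw [transport_map _ hr α, coord_map, ih]
    by_cases hi : i.val ≤ p.val
    · split_ifs <;> first | rfl | omega
    · rw [eq_zero_of_notMem (fun h => hi h.1) x]
      simp

/-- A vector `x` of `X` at `i` that dies beyond `j` defines a morphism from `E^{ij}`, which sends
`1` at `i` to `x`. -/
noncomputable def fromInterval {X : QRep K (AVertex n)} {i : AVertex n} (j : AVertex n) (x : X.V i)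
    (hx : ∀ (p : AVertex n) (h : i.val ≤ p.val), j.val < p.val → X.transport h x = 0) :
    intervalRep K i j ⟶ X where
  app p := if h : i.val ≤ p.val then
    LinearMap.toSpanSingleton K _ (X.transport h x) ∘ₗ coord i j p else 0
  comm := by
    intro p q α
    have hα : p.val + 1 = q.val := α.down
    refine LinearMap.ext fun e => ?_
    by_cases hp : i.val ≤ p.val
    · have hq : i.val ≤ q.val := by omega
      simp only [LinearMap.comp_apply, dif_pos hp, dif_pos hq, LinearMap.toSpanSingleton_apply,
        map_smul, coord_map, ← X.transport_map hp α hq]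
      split_ifs with h
      · rfl
      · rw [hx q hq (by omega), smul_zero, smul_zero]
    · rw [eq_zero_of_notMem (fun h => hp h.1) e, map_zero, map_zero]

theorem fromInterval_app {X : QRep K (AVertex n)} {i j : AVertex n} (x : X.V i)
    (hx : ∀ (p : AVertex n) (h : i.val ≤ p.val), j.val < p.val → X.transport h x = 0)
    {p : AVertex n} (h : i.val ≤ p.val) (e : (intervalRep K i j).V p) :
    Hom.app (fromInterval j x hx) p e = coord i j p e • X.transport h x := by
  simp [fromInterval, dif_pos h]

/-- A linear form `f` on `X` at `j` that vanishes on everything coming from before `i` defines a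
morphism to `E^{ij}`, which is `f` at `j`. -/
noncomputable def toInterval {X : QRep K (AVertex n)} {j : AVertex n} (i : AVertex n)
    (f : X.V j →ₗ[K] K)
    (hf : ∀ (p : AVertex n) (h : p.val ≤ j.val), p.val < i.val → f ∘ₗ X.transport h = 0) :
    X ⟶ intervalRep K i j where
  app p := if h : i.val ≤ p.val ∧ p.val ≤ j.val then
    ofCoord h ∘ₗ f ∘ₗ X.transport h.2 else 0
  comm := by
    intro p q α
    have hα : p.val + 1 = q.val := α.down
    refine LinearMap.ext fun x => coord_injective _ _ _ ?_
    rw [LinearMap.comp_apply, coord_map]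
    by_cases hq : i.val ≤ q.val ∧ q.val ≤ j.val
    · by_cases hp : i.val ≤ p.val
      · have hp' : i.val ≤ p.val ∧ p.val ≤ j.val := ⟨hp, by omega⟩
        rw [LinearMap.comp_apply, dif_pos hq, dif_pos hp', if_pos ⟨hp, hq.2⟩]
        simp [X.transport_map_left α hq.2 hp'.2]
      · have h0 := LinearMap.congr_fun (hf p (by omega) (by omega)) x
        simp only [LinearMap.comp_apply, LinearMap.zero_apply] at h0
        rw [LinearMap.comp_apply, dif_pos hq, if_neg (by omega)]
        simp [X.transport_map_left α hq.2 (by omega), h0]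
    · rw [LinearMap.comp_apply, dif_neg hq, if_neg (by omega)]
      rfl

theorem coord_toInterval_app {X : QRep K (AVertex n)} {i j : AVertex n} (f : X.V j →ₗ[K] K)
    (hf : ∀ (p : AVertex n) (h : p.val ≤ j.val), p.val < i.val → f ∘ₗ X.transport h = 0)
    {p : AVertex n} (h : i.val ≤ p.val ∧ p.val ≤ j.val) (x : X.V p) :
    coord i j p (Hom.app (toInterval i f hf) p x) = f (X.transport h.2 x) := by
  unfold toInterval
  dsimp only
  rw [dif_pos h]
  simp

/-- The projection of `E^{ij}` onto its quotient `E^{ij'}`, where `i ≤ j' ≤ j`. -/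
noncomputable def intervalProj {i j j' : AVertex n} (h : i.val ≤ j'.val) (h' : j'.val ≤ j.val) :
    intervalRep K i j ⟶ intervalRep K i j' :=
  fromInterval j (ofCoord ⟨le_rfl, h⟩ 1) fun _ _ hp => eq_zero_of_notMem (by omega) _

theorem coord_intervalProj {i j j' p : AVertex n} (h : i.val ≤ j'.val) (h' : j'.val ≤ j.val)
    (x : (intervalRep K i j).V p) :
    coord i j' p (Hom.app (intervalProj h h') p x) =
      if p.val ≤ j'.val then coord i j p x else 0 := by
  by_cases hp : i.val ≤ p.val
  · rw [intervalProj, fromInterval_app _ _ hp, map_smul, coord_transport, coord_ofCoord]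
    simp
  · rw [eq_zero_of_notMem (fun h => hp h.1) x]
    simp

theorem isSurjection_intervalProj {i j j' : AVertex n} (h : i.val ≤ j'.val)
    (h' : j'.val ≤ j.val) : IsSurjection (intervalProj (K := K) h h') := by
  intro p z
  by_cases hp : i.val ≤ p.val ∧ p.val ≤ j'.val
  · refine ⟨ofCoord ⟨hp.1, hp.2.trans h'⟩ (coord i j' p z), coord_injective _ _ _ ?_⟩
    rw [coord_intervalProj, if_pos hp.2, coord_ofCoord]
  · exact ⟨0, by rw [map_zero, eq_zero_of_notMem hp z]⟩

/-- The inclusion of the subrepresentation `E^{i'j}` into `E^{ij}`, where `i ≤ i' ≤ j`. -/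
noncomputable def intervalIncl {i i' j : AVertex n} (h : i.val ≤ i'.val) (h' : i'.val ≤ j.val) :
    intervalRep K i' j ⟶ intervalRep K i j :=
  fromInterval j (ofCoord ⟨h, h'⟩ 1) fun _ _ hp => eq_zero_of_notMem (by omega) _

theorem coord_intervalIncl {i i' j p : AVertex n} (h : i.val ≤ i'.val) (h' : i'.val ≤ j.val)
    (x : (intervalRep K i' j).V p) :
    coord i j p (Hom.app (intervalIncl h h') p x) = coord i' j p x := by
  by_cases hp : i'.val ≤ p.val ∧ p.val ≤ j.val
  · rw [intervalIncl, fromInterval_app _ _ hp.1, map_smul, coord_transport, coord_ofCoord,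
      if_pos hp.2, smul_eq_mul, mul_one]
  · rw [eq_zero_of_notMem hp x]
    simp

/-- Cutting the interval `[i, j]` into `[i, l]` and `[l + 1, j]` makes `E^{ij}` an extension. -/
theorem isExtension_intervalRep {i l i' j : AVertex n} (hil : i.val ≤ l.val)
    (hl : l.val + 1 = i'.val) (h' : i'.val ≤ j.val) :
    IsExtension (intervalRep K i j) (intervalRep K i l) (intervalRep K i' j) := by
  have hii' : i.val ≤ i'.val := by omega
  have hlj : l.val ≤ j.val := by omega
  refine isExtension_of_exact (intervalIncl hii' h') (intervalProj hil hlj) (fun p x y h => ?_)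
    (isSurjection_intervalProj hil hlj) fun p => le_antisymm ?_ fun y hy => ?_
  · apply coord_injective
    rw [← coord_intervalIncl hii' h', ← coord_intervalIncl hii' h', h]
  · rintro _ ⟨x, rfl⟩
    apply coord_injective
    rw [coord_intervalProj, coord_intervalIncl, map_zero]
    split_ifs with hp
    · rw [eq_zero_of_notMem (by omega) x, map_zero]
    · rfl
  · have hy' := congrArg (coord i l p) (LinearMap.mem_ker.1 hy)
    rw [coord_intervalProj, map_zero] at hy'
    by_cases hp : i'.val ≤ p.val ∧ p.val ≤ j.val
    · refine ⟨ofCoord hp (coord i j p y), coord_injective _ _ _ ?_⟩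
      rw [coord_intervalIncl, coord_ofCoord]
    · refine ⟨0, intervalRep_ext fun h1 h2 => ?_⟩
      rw [if_pos (by omega)] at hy'
      rw [hy', map_zero, map_zero]

/-- `E^{ij}` is generated at the vertex `i`, so a quotient that vanishes at `i` vanishes. -/
theorem isZeroRep_of_intervalRep {i j : AVertex n} {Z : QRep K (AVertex n)}
    (g : intervalRep K i j ⟶ Z) (hg : IsSurjection g) (hZ : ∀ z : Z.V i, z = 0) :
    Z.IsZeroRep := by
  intro p
  refine subsingleton_of_forall_eq 0 fun z => ?_
  obtain ⟨x, rfl⟩ := hg p z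
  by_cases hp : i.val ≤ p.val ∧ p.val ≤ j.val
  · have hx : x = (intervalRep K i j).transport hp.1
        (ofCoord ⟨le_rfl, hp.1.trans hp.2⟩ (coord i j p x)) := by
      apply coord_injective
      rw [coord_transport, if_pos hp.2, coord_ofCoord]
    rw [hx, app_transport, hZ (Hom.app g i _), map_zero]
  · rw [eq_zero_of_notMem hp x, map_zero]

theorem isIndecomposable_intervalRep {i j : AVertex n} (h : i.val ≤ j.val) :
    (intervalRep K i j).IsIndecomposable := by
  refine ⟨fun h0 => ?_, fun Y Z ⟨e⟩ => ?_⟩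
  · have h01 := congrArg (coord i j i)
      ((h0 i).elim (ofCoord ⟨le_rfl, h⟩ (0 : K)) (ofCoord ⟨le_rfl, h⟩ 1))
    rw [coord_ofCoord, coord_ofCoord] at h01
    exact zero_ne_one h01
  · let π₁ : directSum Y Z ⟶ Y := { app := fun p => LinearMap.fst K _ _, comm := fun _ => rfl }
    let π₂ : directSum Y Z ⟶ Z := { app := fun p => LinearMap.snd K _ _, comm := fun _ => rfl }
    have hπ₁ : IsSurjection π₁ := fun p y => ⟨(y, 0), rfl⟩
    have hπ₂ : IsSurjection π₂ := fun p z => ⟨(0, z), rfl⟩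
    by_cases hY : ∀ y : Y.V i, y = 0
    · exact Or.inl (isZeroRep_of_intervalRep _ ((isSurjection_hom e).comp hπ₁) hY)
    by_cases hZ : ∀ z : Z.V i, z = 0
    · exact Or.inr (isZeroRep_of_intervalRep _ ((isSurjection_hom e).comp hπ₂) hZ)
    -- Otherwise `(y, 0)` and `(0, z)` are linearly independent in a one-dimensional space.
    push Not at hY hZ
    obtain ⟨y, hy⟩ := hY
    obtain ⟨z, hz⟩ := hZ
    obtain ⟨x₁, hx₁⟩ := isSurjection_hom e i (y, 0)
    obtain ⟨x₂, hx₂⟩ := isSurjection_hom e i (0, z)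
    have hx : coord i j i x₂ • x₁ = coord i j i x₁ • x₂ := by
      apply coord_injective
      rw [map_smul, map_smul, smul_eq_mul, smul_eq_mul, mul_comm]
    have hx' := congrArg (Hom.app e.hom i) hx
    rw [map_smul, map_smul, hx₁, hx₂] at hx'
    have h1 : coord i j i x₂ • y = coord i j i x₁ • (0 : Y.V i) := congrArg Prod.fst hx'
    rw [smul_zero, smul_eq_zero] at h1
    have h2 : x₂ = 0 := coord_injective _ _ _ ((h1.resolve_right hy).trans (map_zero _).symm)
    rw [h2, map_zero] at hx₂
    exact absurd (congrArg Prod.snd hx₂).symm hz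

/-! ### Decomposition into interval representations -/

/-- A nonzero representation has an interval summand. It starts at the first vertex `i` where the
representation is nonzero and ends at the last vertex `j` for which the transport from `i` to `j`
is nonzero: a vector at `i` surviving to `j` embeds `E^{ij}`, because everything at `i` dies
beyond `j`, and a linear form at `j` not vanishing on it gives a retraction, because nothing comes
from before `i`. -/
theorem exists_iso_directSum_intervalRep {X : QRep K (AVertex n)} (hX : ¬ X.IsZeroRep) :
    ∃ i j : AVertex n, i.val ≤ j.val ∧
      ∃ W, Nonempty (X ≅ directSum (intervalRep K i j) W) := by
  obtain ⟨i, hi, himin⟩ := Set.exists_min_image {p : AVertex n | Nontrivial (X.V p)} AVertex.val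
    (Set.toFinite _) (by
      unfold IsZeroRep at hX
      push Not at hX
      obtain ⟨p, hp⟩ := hX
      exact ⟨p, hp⟩)
  obtain ⟨j, ⟨hij, hj⟩, hjmax⟩ := Set.exists_max_image
    {q : AVertex n | ∃ h : i.val ≤ q.val, X.transport h ≠ 0} AVertex.val (Set.toFinite _) (by
      obtain ⟨x, hx⟩ := @exists_ne _ hi (0 : X.V i)
      refine ⟨i, le_rfl, fun h => hx ?_⟩
      rw [transport_self] at h
      exact LinearMap.congr_fun h x)
  obtain ⟨x, hx⟩ : ∃ x, X.transport hij x ≠ 0 := by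
    by_contra! h
    exact hj (LinearMap.ext h)
  obtain ⟨f, hf⟩ : ∃ f : X.V j →ₗ[K] K, f (X.transport hij x) = 1 :=
    Module.Projective.exists_dual_eq_one K hx
  refine ⟨i, j, hij, _, nonempty_iso_directSum_ker
    (fromInterval j x fun p h hp => ?_) (toInterval i f fun p h hp => ?_) fun p e => ?_⟩
  · by_contra h0
    have := hjmax p ⟨h, fun h1 => h0 (by rw [h1]; rfl)⟩
    omega
  · have : Subsingleton (X.V p) := not_nontrivial_iff_subsingleton.1 fun hp' => by
      have := himin p hp'
      omega
    refine LinearMap.ext fun y => ?_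
    rw [Subsingleton.elim y 0, map_zero, map_zero]
  · refine intervalRep_ext fun h1 h2 => ?_
    rw [coord_toInterval_app _ _ ⟨h1, h2⟩, fromInterval_app _ _ h1, map_smul,
      transport_transport, map_smul, hf, smul_eq_mul, mul_one]

theorem finrank_directSum {X A B : QRep K (AVertex n)} (e : X ≅ directSum A B) (p : AVertex n) :
    Module.finrank K (X.V p) = Module.finrank K (A.V p) + Module.finrank K (B.V p) := by
  rw [← Module.finrank_prod]
  exact (LinearEquiv.ofBijective _ (bijective_hom_app e p)).finrank_eq

/-- Every representation of `A_n` is a finite direct sum of interval representations. -/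
theorem exists_iso_finDirectSum_intervalRep (X : QRep K (AVertex n)) :
    ∃ (m : ℕ) (Y : Fin m → QRep K (AVertex n)),
      (∀ k, ∃ i j : AVertex n, i.val ≤ j.val ∧ Y k = intervalRep K i j) ∧
        Nonempty (X ≅ finDirectSum Y) := by
  have := Fintype.ofFinite (AVertex n)
  induction hd : ∑ p, Module.finrank K (X.V p) using Nat.strong_induction_on generalizing X with
  | _ d ih =>
  by_cases hX : X.IsZeroRep
  · exact ⟨0, Fin.elim0, fun k => k.elim0, hX.nonempty_iso_finDirectSum _⟩
  · obtain ⟨i, j, hij, W, ⟨e⟩⟩ := exists_iso_directSum_intervalRep hX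
    obtain ⟨m, Y, hY, ⟨e'⟩⟩ := ih _ (by
      rw [← hd]
      refine Finset.sum_lt_sum (fun p _ => ?_) ⟨i, Finset.mem_univ i, ?_⟩
      · rw [finrank_directSum e]
        exact Nat.le_add_left _ _
      · rw [finrank_directSum e]
        refine Nat.lt_add_of_pos_left (Module.finrank_pos_iff_exists_ne_zero.2
          ⟨ofCoord ⟨le_rfl, hij⟩ 1, fun h => one_ne_zero (α := K) ?_⟩)
        rw [← coord_ofCoord (⟨le_rfl, hij⟩ : i.val ≤ i.val ∧ i.val ≤ j.val) (1 : K), h,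
          map_zero]) W rfl
    refine ⟨m + 1, Fin.cons (intervalRep K i j) Y, fun k => ?_,
      nonempty_iso_finDirectSum_cons Y e e'⟩
    refine Fin.cases ⟨i, j, hij, rfl⟩ (fun k => ?_) k
    exact hY k

/-! ### The image criterion -/

/-- The image of the space at the vertex `k` in the space at `m`; it is zero unless `1 ≤ k ≤ m`.
The value `k = 0` stands for the zero space preceding the first vertex. -/
noncomputable def imageFrom (X : QRep K (AVertex n)) (k : ℕ) (m : AVertex n) :
    Submodule K (X.V m) :=
  if h : 1 ≤ k ∧ k ≤ m.val then
    LinearMap.range (X.transport (p := ⟨k, h.1, h.2.trans m.le⟩) h.2)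
  else ⊥

theorem imageFrom_val (X : QRep K (AVertex n)) {p m : AVertex n} (h : p.val ≤ m.val) :
    X.imageFrom p.val m = LinearMap.range (X.transport h) :=
  dif_pos ⟨p.one_le, h⟩

theorem imageFrom_self (X : QRep K (AVertex n)) (m : AVertex n) : X.imageFrom m.val m = ⊤ := by
  rw [imageFrom_val X le_rfl, transport_self, LinearMap.range_id]

theorem map_transport_imageFrom (X : QRep K (AVertex n)) {k : ℕ} {m m' : AVertex n}
    (hk : k ≤ m.val) (h : m.val ≤ m'.val) :
    (X.imageFrom k m).map (X.transport h) = X.imageFrom k m' := by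
  unfold imageFrom
  by_cases h1 : 1 ≤ k
  · rw [dif_pos ⟨h1, hk⟩, dif_pos ⟨h1, hk.trans h⟩, ← LinearMap.range_comp]
    congr 1
    exact LinearMap.ext fun x => transport_transport X _ _ x
  · rw [dif_neg (fun h => h1 h.1), dif_neg (fun h => h1 h.1), Submodule.map_bot]

theorem map_app_imageFrom_le {X Y : QRep K (AVertex n)} (f : X ⟶ Y) (k : ℕ) (m : AVertex n) :
    (X.imageFrom k m).map (Hom.app f m) ≤ Y.imageFrom k m := by
  unfold imageFrom
  split_ifs with h
  · rintro _ ⟨_, ⟨x, rfl⟩, rfl⟩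
    exact ⟨_, (app_transport f _ x).symm⟩
  · rw [Submodule.map_bot]

theorem map_app_imageFrom {X Y : QRep K (AVertex n)} {f : X ⟶ Y} (hf : IsSurjection f) (k : ℕ)
    (m : AVertex n) : (X.imageFrom k m).map (Hom.app f m) = Y.imageFrom k m := by
  refine le_antisymm (map_app_imageFrom_le f k m) ?_
  unfold imageFrom
  split_ifs with h
  · rintro _ ⟨y, rfl⟩
    obtain ⟨x, rfl⟩ := hf _ y
    exact ⟨_, ⟨x, rfl⟩, app_transport f _ x⟩
  · exact bot_le

/-- The condition that, for each vertex `i`, everything at `i` that survives to the vertex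
`i + a_i` agrees there with something coming from `i - 1`. In terms of a decomposition into
intervals, it says that a summand starting at `i` ends before `i + a_i`. There is no condition
at `i` when `i + a_i = n + 1`. -/
def IsShort (a : AVertex n → ℕ) (X : QRep K (AVertex n)) : Prop :=
  ∀ i m : AVertex n, m.val = i.val + a i → X.imageFrom i.val m ≤ X.imageFrom (i.val - 1) m

variable {a : AVertex n → ℕ}

theorem IsShort.of_isSurjection {X Y : QRep K (AVertex n)} (hX : IsShort a X) {f : X ⟶ Y}
    (hf : IsSurjection f) : IsShort a Y := by
  intro i m hm
  rw [← map_app_imageFrom hf, ← map_app_imageFrom hf]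
  exact Submodule.map_mono (hX i m hm)

/-- For a bracket vector, the intervals starting in `[i, i + a_i]` end before `i + a_i`, so that
the whole space at `i + a_i` comes from `i - 1`. -/
theorem IsShort.imageFrom_eq_top (ha : IsBracketVector a) {X : QRep K (AVertex n)}
    (hX : IsShort a X) {i m : AVertex n} (hm : m.val = i.val + a i) :
    X.imageFrom (i.val - 1) m = ⊤ := by
  have key : ∀ k, i.val - 1 ≤ k → k ≤ m.val → X.imageFrom k m ≤ X.imageFrom (i.val - 1) m := by
    intro k hk
    induction k, hk using Nat.le_induction with
    | base => exact fun _ => le_rfl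
    | succ k hk ih =>
      intro hkm
      refine le_trans ?_ (ih (by omega))
      have hi := i.one_le
      let p : AVertex n := ⟨k + 1, by omega, hkm.trans m.le⟩
      have hb := ha.bracket i (k + 1 - i.val) (by omega)
      rw [show i.val + (k + 1 - i.val) = k + 1 by omega, AVertex.entry,
        dif_pos ⟨p.one_le, p.le⟩] at hb
      change k + 1 - i.val + a p ≤ a i at hb
      have hpm : k + 1 + a p ≤ m.val := by omega
      let m' : AVertex n := ⟨k + 1 + a p, by omega, hpm.trans m.le⟩
      have h := Submodule.map_mono (f := X.transport (p := m') (q := m) hpm) (hX p m' rfl)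
      rwa [map_transport_imageFrom X (Nat.le_add_right _ _),
        map_transport_imageFrom X ((Nat.sub_le _ _).trans (Nat.le_add_right _ _))] at h
  rw [eq_top_iff, ← imageFrom_self]
  exact key _ (by omega) le_rfl

theorem IsShort.of_isExtension (ha : IsBracketVector a) (X Y Z : QRep K (AVertex n))
    (h : IsExtension Y Z X) (hX : IsShort a X) (hZ : IsShort a Z) : IsShort a Y := by
  obtain ⟨f, g, hg, hfg⟩ := h.exists_exact
  intro i m hm y hy
  have hgy := hZ i m hm (map_app_imageFrom_le g _ _ (Submodule.mem_map_of_mem hy))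
  rw [← map_app_imageFrom hg] at hgy
  obtain ⟨y', hy', hyy'⟩ := hgy
  obtain ⟨x, hx⟩ := hfg m (y - y') (by rw [map_sub, hyy', sub_self])
  have hx' : Hom.app f m x ∈ Y.imageFrom (i.val - 1) m :=
    map_app_imageFrom_le f _ _ (Submodule.mem_map_of_mem (by
      rw [hX.imageFrom_eq_top ha hm]; trivial))
  rw [hx] at hx'
  rw [← sub_add_cancel y y']
  exact add_mem hx' hy'

theorem IsZeroRep.isShort {X : QRep K (AVertex n)} (hX : X.IsZeroRep) : IsShort a X := by
  intro i m _ x _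
  rw [(hX m).elim x 0]
  exact zero_mem _

theorem isShort_intervalRep_iff {i j : AVertex n} (hij : i.val ≤ j.val) :
    IsShort a (intervalRep K i j) ↔ j.val < i.val + a i := by
  constructor
  · intro h
    by_contra! hj
    let m : AVertex n := ⟨i.val + a i, by have := i.one_le; omega, hj.trans j.le⟩
    have him : i.val ≤ m.val := Nat.le_add_right _ _
    have h1 : (intervalRep K i j).transport him (ofCoord ⟨le_rfl, hij⟩ (1 : K)) ∈
        (intervalRep K i j).imageFrom (i.val - 1) m := by
      refine h i m rfl ?_
      rw [imageFrom_val _ him]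
      exact ⟨_, rfl⟩
    have h2 : (intervalRep K i j).imageFrom (i.val - 1) m = ⊥ := by
      unfold imageFrom
      split_ifs with h3
      · rw [LinearMap.range_eq_bot]
        refine LinearMap.ext fun x => ?_
        have hx : x = 0 := eq_zero_of_notMem (by dsimp only; omega) x
        rw [hx, map_zero, map_zero]
      · rfl
    rw [h2, Submodule.mem_bot] at h1
    have h3 := congrArg (coord i j m) h1
    rw [coord_transport, if_pos hj, coord_ofCoord, map_zero] at h3
    exact one_ne_zero h3
  · intro h k m hm
    have hkm : k.val ≤ m.val := by omega
    rw [imageFrom_val _ hkm]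
    rintro _ ⟨x, rfl⟩
    by_cases hk : i.val ≤ k.val ∧ m.val ≤ j.val
    · have hik : i.val < k.val := by
        refine lt_of_le_of_ne hk.1 fun h' => ?_
        obtain rfl : i = k := AVertex.ext h'
        omega
      have hi := i.one_le
      let p : AVertex n := ⟨k.val - 1, by omega, (Nat.sub_le _ _).trans k.le⟩
      have hip : i.val ≤ p.val := Nat.le_sub_one_of_lt hik
      have hpm : p.val ≤ m.val := (Nat.sub_le _ _).trans hkm
      change _ ∈ imageFrom _ p.val m
      rw [imageFrom_val _ hpm]
      refine ⟨ofCoord ⟨hip, hpm.trans hk.2⟩ (coord i j k x), coord_injective _ _ _ ?_⟩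
      rw [coord_transport, coord_transport, coord_ofCoord]
    · have h0 : (intervalRep K i j).transport hkm x = 0 := by
        refine intervalRep_ext fun h1 h2 => ?_
        rw [eq_zero_of_notMem (by omega) x, map_zero]
      rw [h0]
      exact zero_mem _

theorem bracketSubcategory_iff_isShort (ha : IsBracketVector a) (X : QRep K (AVertex n)) :
    bracketSubcategory K a X ↔ IsShort a X := by
  constructor
  · rintro ⟨m, Y, hY, ⟨e⟩⟩
    refine IsShort.of_isSurjection (prop_finDirectSum (T := IsShort a)
      (fun _ => IsZeroRep.isShort) (IsShort.of_isExtension ha) Y fun k => ?_)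
      (isSurjection_hom e.symm)
    obtain ⟨i, j, hij, hj, hk⟩ := hY k
    rw [hk]
    exact (isShort_intervalRep_iff hij).2 hj
  · intro hX
    obtain ⟨m, Y, hY, ⟨e⟩⟩ := exists_iso_finDirectSum_intervalRep X
    refine ⟨m, Y, fun k => ?_, ⟨e⟩⟩
    have hk := hX.of_isSurjection ((isSurjection_hom e).comp (isSurjection_finDirectSumProj Y k))
    obtain ⟨i, j, hij, h⟩ := hY k
    rw [h] at hk
    exact ⟨i, j, hij, (isShort_intervalRep_iff hij).1 hk, h⟩

/-! ### Torsion classes -/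

theorem isTorsionClass_bracketSubcategory (ha : IsBracketVector a) :
    IsTorsionClass (bracketSubcategory K a) where
  additive := ⟨_, by
    rintro _ ⟨i, j, hij, -, rfl⟩
    exact isIndecomposable_intervalRep hij, rfl⟩
  quotient Y Z f hf hY := by
    rw [bracketSubcategory_iff_isShort ha] at hY ⊢
    exact hY.of_isSurjection hf
  extension X Y Z h hX hZ := by
    rw [bracketSubcategory_iff_isShort ha] at hX hZ ⊢
    exact IsShort.of_isExtension ha X Y Z h hX hZ

theorem IsTorsionClass.of_isZeroRep {T : ObjectProperty (QRep K (AVertex n))}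
    (hT : IsTorsionClass T) {X : QRep K (AVertex n)} (hX : X.IsZeroRep) : T X := by
  obtain ⟨S, -, rfl⟩ := hT.additive
  exact ⟨0, Fin.elim0, fun k => k.elim0, hX.nonempty_iso_finDirectSum _⟩

open Classical in
/-- The vector of a class `T` of representations of `A_n`: its entry at `i` is the number of
vertices of the longest interval `[i, j]` with `E^{ij}` in `T`, or `0` if there is none. -/
noncomputable def lengthVector (T : ObjectProperty (QRep K (AVertex n))) (i : AVertex n) : ℕ :=
  Nat.findGreatest (fun l => ∃ j : AVertex n, j.val + 1 = i.val + l ∧ T (intervalRep K i j))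
    (n + 1 - i.val)

theorem lengthVector_le (T : ObjectProperty (QRep K (AVertex n))) (i : AVertex n) :
    lengthVector T i ≤ n + 1 - i.val := by
  classical exact Nat.findGreatest_le _

variable {T : ObjectProperty (QRep K (AVertex n))}

theorem IsTorsionClass.intervalRep_iff (hT : IsTorsionClass T) {i j : AVertex n}
    (hij : i.val ≤ j.val) : T (intervalRep K i j) ↔ j.val < i.val + lengthVector T i := by
  classical
  constructor
  · intro h
    have hj := j.le
    have hl : j.val + 1 - i.val ≤ lengthVector T i :=
      Nat.le_findGreatest (by omega) ⟨j, by omega, h⟩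
    omega
  · intro h
    obtain ⟨j', hj', hT'⟩ := Nat.findGreatest_of_ne_zero
      (rfl : lengthVector T i = lengthVector T i) (by omega)
    exact hT.quotient _ _ _ (isSurjection_intervalProj hij (by omega)) hT'

theorem IsTorsionClass.isBracketVector (hT : IsTorsionClass T) :
    IsBracketVector (lengthVector T) where
  bound := lengthVector_le T
  bracket i l hl := by
    unfold AVertex.entry
    split_ifs with h
    swap
    -- For `i + l = n + 1` the entry is `0` by convention.
    · exact hl
    let i' : AVertex n := ⟨i.val + l, h.1, h.2⟩
    change l + lengthVector T i' ≤ _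
    by_contra! hlt
    have hl0 : l ≠ 0 := by
      rintro rfl
      rw [zero_add] at hlt
      exact lt_irrefl _ hlt
    have hi := i.one_le
    have hb : lengthVector T i' ≤ n + 1 - i'.val := lengthVector_le T i'
    have hi' : i'.val = i.val + l := rfl
    have hi'n := i'.le
    -- `E^{ij}`, with `j` the end of the longest interval at `i'`, is an extension.
    let j : AVertex n := ⟨i'.val + lengthVector T i' - 1, by omega, by omega⟩
    let p : AVertex n := ⟨i'.val - 1, by omega, by omega⟩
    have hj : j.val = i'.val + lengthVector T i' - 1 := rfl
    have hp : p.val = i'.val - 1 := rfl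
    have h1 : T (intervalRep K i p) := (hT.intervalRep_iff (by omega)).2 (by omega)
    have h2 : T (intervalRep K i' j) := (hT.intervalRep_iff (by omega)).2 (by omega)
    have h3 := hT.extension _ _ _
      (isExtension_intervalRep (by omega) (by omega) (by omega)) h2 h1
    have h4 := (hT.intervalRep_iff (by omega)).1 h3
    omega

theorem IsTorsionClass.eq_bracketSubcategory (hT : IsTorsionClass T) :
    T = bracketSubcategory K (lengthVector T) := by
  funext X
  refine propext ⟨fun hX => ?_, ?_⟩
  · obtain ⟨m, Y, hY, ⟨e⟩⟩ := exists_iso_finDirectSum_intervalRep X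
    refine ⟨m, Y, fun k => ?_, ⟨e⟩⟩
    have hk := hT.quotient _ _ _
      ((isSurjection_hom e).comp (isSurjection_finDirectSumProj Y k)) hX
    obtain ⟨i, j, hij, h⟩ := hY k
    rw [h] at hk
    exact ⟨i, j, hij, (hT.intervalRep_iff hij).1 hk, h⟩
  · rintro ⟨m, Y, hY, ⟨e⟩⟩
    refine hT.quotient _ _ _ (isSurjection_hom e.symm)
      (prop_finDirectSum (fun _ => hT.of_isZeroRep) hT.extension Y fun k => ?_)
    obtain ⟨i, j, hij, hj, hk⟩ := hY k
    rw [hk]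
    exact (hT.intervalRep_iff hij).2 hj

end Path

end QRep

theorem mainTheorem2 (K : Type u) [Field K] (n : ℕ) (T : ObjectProperty (QRep K (AVertex n))) :
    QRep.IsTorsionClass T ↔
      ∃ a : AVertex n → ℕ, IsBracketVector a ∧ T = bracketSubcategory K a := by
  constructor
  · exact fun hT => ⟨QRep.lengthVector T, hT.isBracketVector, hT.eq_bracketSubcategory⟩
  · rintro ⟨a, ha, rfl⟩
    exact QRep.isTorsionClass_bracketSubcategory ha
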